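/- There are $I$ individuals and one group. Individual $j\in\{1,\dots,I\}$ has true caliber $A_j\in\mathbb R$ and is either a member of the group ($c_j=1$) or a competitor of it ($c_j=-1$); the true discrimination in favor of the group is $\Theta\in\mathbb R$. In every period $t=1,2,\dots$, a fixed individual $i$ (the agent) observes, for all $j=1,\dots,I$, the recognitions $q_j=A_j+c_j\Theta+\epsilon^q_j$ and the signals about caliber $s_j=A_j+\epsilon^a_j$, and the signal about discrimination $\eta=\Theta+\epsilon^\eta$. All errors are independent, across signals and periods, with $\epsilon^q_j\sim N(0,v^q)$, $\epsilon^a_j\sim N(0,v^a)$, $\epsilon^\eta\sim N(0,v^\eta)$ and $v^q,v^a,v^\eta>0$. The agent believes that the vector of signals $(q,\eta,s)$ is drawn independently over time from a normal distribution with mean $\big((a_j+c_j\theta)_{j},\,\theta,\,(a_j)_{j}\big)$ and covariance matrix $S$, where $(a,\theta,S)\in\mathbb R^I\times\mathbb R\times\{\text{positive definite }(2I+1)\times(2I+1)\text{ matrices}\}$ is unknown, and updates his beliefs by Bayes' rule. He is overconfident: he is certain that his own caliber is $\tilde a_i>A_i$; otherwise his prior is agnostic, i.e. it is a Borel probability measure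 whose support is $\{(a,\theta,S): a_i=\tilde a_i\}$. Then there is a unique point $(\tilde a^i,\tilde\theta^i,\tilde S)$ on which the agent's beliefs concentrate: almost surely, for every open set containing this point, the posterior probability of that set after $t$ periods converges to $1$ as $t\to\infty$. The agent's long-run bias about discrimination is $$\tilde\theta^i-\Theta=\frac{-v^\eta(v^q+v^a)c_i}{(v^q+v^\eta)(v^q+v^a)+(I-1)v^qv^\eta}\,(\tilde a_i-A_i),$$ and his long-run bias about every other individual $j\neq i$ is $$\tilde a^i_j-A_j=\frac{v^\eta v^a c_ic_j}{(v^q+v^\eta)(v^q+v^a)+(I-1)v^qv^\eta}\,(\tilde a_i-A_i).$$ -/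

import Mathlib

open MeasureTheory ProbabilityTheory Filter Topology
open scoped ENNReal NNReal Matrix

noncomputable section

/-! ### Bayesian updating in a Gaussian model with unknown mean parameters and covariance -/

/-- The positive definite real matrices indexed by `D`, with the topology inherited from the
space of all matrices. -/
abbrev PDMatrix (D : Type*) [Fintype D] : Type _ := {S : Matrix D D ℝ // S.PosDef}

instance PDMatrix.instMeasurableSpace (D : Type*) [Fintype D] : MeasurableSpace (PDMatrix D) :=
  borel _

instance PDMatrix.instBorelSpace (D : Type*) [Fintype D] : BorelSpace (PDMatrix D) := ⟨rfl⟩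

/-- Lebesgue density at `x` of the Gaussian law on `ℝ^D` with mean `m` and covariance matrix
`S`. -/
def gaussianDensity {D : Type*} [Fintype D] [DecidableEq D]
    (m : D → ℝ) (S : Matrix D D ℝ) (x : D → ℝ) : ℝ :=
  (Real.sqrt ((2 * Real.pi) ^ Fintype.card D * S.det))⁻¹ *
    Real.exp (-(1 / 2) * ((x - m) ⬝ᵥ (S⁻¹ *ᵥ (x - m))))

/-- Likelihood of the first `t` signals `r 0, …, r (t - 1)` when the fundamentals are `p.1` and the
error covariance matrix is `p.2`; `mean f` is the expected signal under fundamentals `f`. -/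
def likelihood {F D : Type*} [Fintype D] [DecidableEq D] (mean : F → D → ℝ) (r : ℕ → D → ℝ)
    (t : ℕ) (p : F × PDMatrix D) : ℝ :=
  ∏ z ∈ Finset.range t, gaussianDensity (mean p.1) p.2.1 (r z)

/-- Posterior probability, by Bayes' rule, of the event `A` after the first `t` signals, for an
agent with prior `P₀` over fundamentals and covariance matrices. -/
def posteriorProb {F D : Type*} [MeasurableSpace F] [Fintype D] [DecidableEq D]
    (P₀ : Measure (F × PDMatrix D)) (mean : F → D → ℝ) (r : ℕ → D → ℝ) (t : ℕ)
    (A : Set (F × PDMatrix D)) : ℝ≥0∞ :=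
  (∫⁻ p in A, ENNReal.ofReal (likelihood mean r t p) ∂P₀) /
    (∫⁻ p, ENNReal.ofReal (likelihood mean r t p) ∂P₀)

/-- Along the signal sequence `r`, the posteriors concentrate on the point `p`. -/
def ConcentratesOn {F D : Type*} [TopologicalSpace F] [MeasurableSpace F] [Fintype D]
    [DecidableEq D] (P₀ : Measure (F × PDMatrix D)) (mean : F → D → ℝ) (r : ℕ → D → ℝ)
    (p : F × PDMatrix D) : Prop :=
  ∀ A : Set (F × PDMatrix D), IsOpen A → p ∈ A →
    Tendsto (fun t => posteriorProb P₀ mean r t A) atTop (𝓝 1)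

/-- `p` is the long-run belief of an agent with prior `P₀` who observes the random signals `r`:
almost surely, the posteriors concentrate on `p`. -/
def IsLongRunBelief {Ω F D : Type*} [MeasurableSpace Ω] [TopologicalSpace F] [MeasurableSpace F]
    [Fintype D] [DecidableEq D] (P : Measure Ω) (P₀ : Measure (F × PDMatrix D))
    (mean : F → D → ℝ) (r : ℕ → Ω → D → ℝ) (p : F × PDMatrix D) : Prop :=
  ∀ᵐ ω ∂P, ConcentratesOn P₀ mean (fun t => r t ω) p

/-- There is at most one point on which the posteriors concentrate. -/
theorem ConcentratesOn.unique {F D : Type*} [TopologicalSpace F] [T2Space F] [MeasurableSpace F]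
    [Fintype D] [DecidableEq D] [OpensMeasurableSpace (F × PDMatrix D)]
    {P₀ : Measure (F × PDMatrix D)} {mean : F → D → ℝ} {r : ℕ → D → ℝ} {p p' : F × PDMatrix D}
    (h : ConcentratesOn P₀ mean r p) (h' : ConcentratesOn P₀ mean r p') : p = p' := by
  by_contra hne
  obtain ⟨U, V, hU, hV, hpU, hpV, hd⟩ := t2_separation hne
  have hlim := (h U hU hpU).add (h' V hV hpV)
  have hle : ∀ t, posteriorProb P₀ mean r t U + posteriorProb P₀ mean r t V ≤ 1 := by
    intro t
    unfold posteriorProb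
    rw [← ENNReal.add_div, ← lintegral_union hV.measurableSet hd]
    exact (ENNReal.div_le_div_right (setLIntegral_le_lintegral _ _) _).trans ENNReal.div_self_le_one
  have h2 : (1 : ℝ≥0∞) + 1 ≤ 1 := le_of_tendsto' hlim hle
  norm_num at h2

/-! ### The one-group model with observations of recognition, discrimination and caliber -/

/-- The fundamentals in a society of `I` individuals and one group: the vector of calibers, and
the discrimination in favor of the group. -/
abbrev Fundamentals (I : ℕ) : Type := (Fin I → ℝ) × ℝ

/-- The one-dimensional signals observed in one period. -/
inductive SignalIdx (I : ℕ) : Type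
  /-- the recognition of individual `j` -/
  | recognition (j : Fin I) : SignalIdx I
  /-- the signal about discrimination -/
  | discrimination : SignalIdx I
  /-- the signal about the caliber of individual `j` -/
  | caliber (j : Fin I) : SignalIdx I
  deriving DecidableEq, Fintype

/-- Expected signals for group relationships `c`, when the calibers are `f.1` and discrimination
is `f.2`: recognition has mean `a j + c j * θ`, the discrimination signal has mean `θ`, and the
signal about the caliber of `j` has mean `a j`. -/
def meanSignal {I : ℕ} (c : Fin I → ℝ) (f : Fundamentals I) : SignalIdx I → ℝ
  | .recognition j => f.1 j + c j * f.2
  | .discrimination => f.2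
  | .caliber j => f.1 j

/-- The true variances of the errors in the signals. -/
def errorVariance {I : ℕ} (vq vη va : ℝ≥0) : SignalIdx I → ℝ≥0
  | .recognition _ => vq
  | .discrimination => vη
  | .caliber _ => va

end

/-! Up to constants, `-2 / t` times the log-likelihood is the contrast `log det S + tr (S⁻¹ (V + w
wᵀ))`, where `V` is the empirical covariance of the errors and `w` is the gap between the sample
mean and the mean of the model. For fixed fundamentals the best covariance is `S = V + w wᵀ`, and
what remains is `card D + log det V + log (1 + wᵀ V⁻¹ w)` (`le_gaussianContrast`,
`eq_of_gaussianContrast_le`). So a free covariance matrix does not change which fundamentals fit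
best: they minimize `wᵀ V⁻¹ w`, and the misfit is absorbed into `S`.

By the strong law, `V` tends to the diagonal matrix of true variances and the mean error to zero.
The limit problem is weighted least squares over `(a, θ)` with `a i` held at the overconfident
value. It is strictly convex, and its first-order conditions are solved by the stated biases
(`weightedSquares_lt`, `longRunBias_foc`).

Convergence of the contrast yields concentration of the posteriors by a Laplace argument
(`concentratesOn_of_tendsto`). The parameter space is not compact: `S` may degenerate or blow up and
the fundamentals may escape. Sublevel sets of the contrast are therefore confined to a compact set,
uniformly in large `t`. -/

noncomputable section

/-! ### Trace and determinant inequalities; compactness in the positive definite cone. -/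

section MatrixInequalities

theorem Matrix.posSemidef_vecMulVec_self {D : Type*} [Fintype D] (w : D → ℝ) :
    (Matrix.vecMulVec w w).PosSemidef := by
  simpa using Matrix.posSemidef_vecMulVec_self_star w

variable {D : Type*} [Fintype D] [DecidableEq D]

/-- This is `log x ≤ x - 1` summed over the eigenvalues; the next lemma is the equality case, where
strictness forces every eigenvalue to be `1`. -/
theorem Matrix.PosDef.log_det_le_trace_sub_card {B : Matrix D D ℝ} (hB : B.PosDef) :
    Real.log B.det ≤ B.trace - Fintype.card D := by
  have hd : B.det = ∏ k, hB.1.eigenvalues k := by simpa using hB.1.det_eq_prod_eigenvalues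
  have ht : B.trace = ∑ k, hB.1.eigenvalues k := by simpa using hB.1.trace_eq_sum_eigenvalues
  rw [hd, ht, Real.log_prod (fun k _ => (hB.eigenvalues_pos k).ne')]
  calc ∑ k, Real.log (hB.1.eigenvalues k) ≤ ∑ k, (hB.1.eigenvalues k - 1) :=
        Finset.sum_le_sum fun k _ => Real.log_le_sub_one_of_pos (hB.eigenvalues_pos k)
    _ = _ := by simp

theorem Matrix.PosDef.eq_one_of_trace_sub_card_le {B : Matrix D D ℝ} (hB : B.PosDef)
    (h : B.trace - Fintype.card D ≤ Real.log B.det) : B = 1 := by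
  have hd : B.det = ∏ k, hB.1.eigenvalues k := by simpa using hB.1.det_eq_prod_eigenvalues
  have ht : B.trace = ∑ k, hB.1.eigenvalues k := by simpa using hB.1.trace_eq_sum_eigenvalues
  have hone : ∀ k, hB.1.eigenvalues k = 1 := by
    intro k
    by_contra hk
    have hlt : ∑ k, Real.log (hB.1.eigenvalues k) < ∑ k, (hB.1.eigenvalues k - 1) :=
      Finset.sum_lt_sum (fun k _ => Real.log_le_sub_one_of_pos (hB.eigenvalues_pos k))
        ⟨k, Finset.mem_univ k, Real.log_lt_sub_one_of_pos (hB.eigenvalues_pos k) hk⟩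
    rw [hd, ht, Real.log_prod (fun k _ => (hB.eigenvalues_pos k).ne')] at h
    simp only [Finset.sum_sub_distrib, Finset.sum_const, Finset.card_univ, nsmul_eq_mul,
      mul_one] at hlt
    linarith
  have hs := hB.1.spectral_theorem
  have : (RCLike.ofReal ∘ hB.1.eigenvalues : D → ℝ) = fun _ => 1 := by
    funext k; simp [hone k]
  rw [this] at hs
  rw [hs]
  simp

open scoped MatrixOrder in
theorem Matrix.PosSemidef.exists_eq_conjTranspose_mul_self {M : Matrix D D ℝ}
    (hM : M.PosSemidef) : ∃ T : Matrix D D ℝ, M = Tᴴ * T :=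
  CStarAlgebra.nonneg_iff_eq_star_mul_self.1 hM.nonneg

theorem Matrix.PosDef.exists_isUnit_eq_conjTranspose_mul_self {M : Matrix D D ℝ}
    (hM : M.PosDef) : ∃ T : Matrix D D ℝ, IsUnit T ∧ M = Tᴴ * T := by
  obtain ⟨T, rfl⟩ := hM.posSemidef.exists_eq_conjTranspose_mul_self
  refine ⟨T, ?_, rfl⟩
  have h := hM.det_pos.ne'
  rw [Matrix.det_mul] at h
  exact (Matrix.isUnit_iff_isUnit_det T).2 (right_ne_zero_of_mul h).isUnit

/-- Write `M = Tᴴ * T`; then `W * M` has the trace and the determinant of `T * W * Tᴴ`. -/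
theorem Matrix.PosDef.log_det_mul_le {W M : Matrix D D ℝ} (hW : W.PosDef) (hM : M.PosDef) :
    Fintype.card D + Real.log M.det ≤ (W * M).trace - Real.log W.det := by
  obtain ⟨T, hT, rfl⟩ := hM.exists_isUnit_eq_conjTranspose_mul_self
  have hB : (T * W * Tᴴ).PosDef :=
    hW.mul_mul_conjTranspose_same (Matrix.vecMul_injective_of_isUnit hT)
  have h := hB.log_det_le_trace_sub_card
  have htr : (W * (Tᴴ * T)).trace = (T * W * Tᴴ).trace := by
    rw [← Matrix.mul_assoc, Matrix.trace_mul_comm, Matrix.mul_assoc]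
  have hdet : (T * W * Tᴴ).det = (Tᴴ * T).det * W.det := by
    simp only [Matrix.det_mul]; ring
  rw [hdet, Real.log_mul hM.det_pos.ne' hW.det_pos.ne'] at h
  linarith

theorem Matrix.PosDef.mul_eq_one_of_le_log_det {W M : Matrix D D ℝ} (hW : W.PosDef)
    (hM : M.PosDef)
    (h : (W * M).trace - Real.log W.det ≤ Fintype.card D + Real.log M.det) : W * M = 1 := by
  obtain ⟨T, hT, rfl⟩ := hM.exists_isUnit_eq_conjTranspose_mul_self
  have hB : (T * W * Tᴴ).PosDef :=
    hW.mul_mul_conjTranspose_same (Matrix.vecMul_injective_of_isUnit hT)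
  have htr : (W * (Tᴴ * T)).trace = (T * W * Tᴴ).trace := by
    rw [← Matrix.mul_assoc, Matrix.trace_mul_comm, Matrix.mul_assoc]
  have hdet : (T * W * Tᴴ).det = (Tᴴ * T).det * W.det := by
    simp only [Matrix.det_mul]; ring
  have h1 : T * W * Tᴴ = 1 := by
    apply hB.eq_one_of_trace_sub_card_le
    rw [hdet, Real.log_mul hM.det_pos.ne' hW.det_pos.ne']
    linarith
  rw [Matrix.mul_assoc] at h1
  rw [← Matrix.mul_assoc]
  exact mul_eq_one_comm.1 h1

theorem Matrix.PosSemidef.trace_mul_nonneg {W M : Matrix D D ℝ} (hW : W.PosSemidef)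
    (hM : M.PosSemidef) : 0 ≤ (W * M).trace := by
  obtain ⟨T, rfl⟩ := hM.exists_eq_conjTranspose_mul_self
  rw [← Matrix.mul_assoc, Matrix.trace_mul_comm, ← Matrix.mul_assoc]
  exact (hW.mul_mul_conjTranspose_same T).trace_nonneg

/-- The rank-one determinant formula; it turns the misfit `w` into an increasing function of the
quadratic form of `V⁻¹`. -/
theorem Matrix.PosDef.log_det_add_vecMulVec {V : Matrix D D ℝ} (hV : V.PosDef) (w : D → ℝ) :
    Real.log (V + Matrix.vecMulVec w w).det =
      Real.log V.det + Real.log (1 + w ⬝ᵥ (V⁻¹ *ᵥ w)) := by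
  have hq : 0 ≤ w ⬝ᵥ (V⁻¹ *ᵥ w) := by
    simpa using hV.inv.posSemidef.dotProduct_mulVec_nonneg w
  have hu : IsUnit V.det := hV.det_pos.ne'.isUnit
  rw [Matrix.vecMulVec_eq Unit, Matrix.det_add_replicateCol_mul_replicateRow hu]
  have hdet : (1 + Matrix.replicateRow Unit w * V⁻¹ * Matrix.replicateCol Unit w).det =
      1 + w ⬝ᵥ (V⁻¹ *ᵥ w) := by
    rw [Matrix.det_unique, Matrix.add_apply, Matrix.one_apply_eq, Matrix.mul_assoc,
      ← Matrix.replicateCol_mulVec, Matrix.replicateRow_mul_replicateCol_apply]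
  rw [hdet, Real.log_mul hV.det_pos.ne' (by positivity)]

theorem Matrix.PosSemidef.abs_apply_le_trace {W : Matrix D D ℝ} (hW : W.PosSemidef) (i j : D) :
    |W i j| ≤ W.trace := by
  have hsym : W j i = W i j := by simpa using hW.1.apply i j
  have hle : ∀ k, W k k ≤ W.trace := fun k =>
    Finset.single_le_sum (f := fun k => W k k) (fun k _ => hW.diag_nonneg) (Finset.mem_univ k)
  -- The quadratic form at `e_i + s e_j`; the values `s = ±1` bound the off-diagonal entry.
  have key : ∀ s : ℝ, 0 ≤ W i i + s * W i j + s * (W i j + s * W j j) := by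
    intro s
    have h := hW.dotProduct_mulVec_nonneg (Pi.single i 1 + s • Pi.single j 1)
    simp [Matrix.mulVec_add, Matrix.mulVec_smul, hsym] at h
    linarith
  have h1 := key 1
  have h2 := key (-1)
  rw [abs_le]
  constructor <;> linarith [hle i, hle j]

/-- The trace bounds every entry, and the lower bound on the determinant keeps away from singular
matrices, so the set is closed even among all matrices. -/
theorem PDMatrix.isCompact_trace_le_det_ge (a b : ℝ) (ha : 0 < a) :
    IsCompact {W : PDMatrix D | W.1.trace ≤ b ∧ a ≤ W.1.det} := by
  have himg : ((↑) : PDMatrix D → Matrix D D ℝ) '' {W | W.1.trace ≤ b ∧ a ≤ W.1.det} =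
      {W : Matrix D D ℝ | W.PosSemidef} ∩ {W | W.trace ≤ b} ∩ {W | a ≤ W.det} := by
    ext W
    constructor
    · rintro ⟨W, hW, rfl⟩
      exact ⟨⟨W.2.posSemidef, hW.1⟩, hW.2⟩
    · rintro ⟨⟨hpsd, htr⟩, hdet⟩
      exact ⟨⟨W, hpsd.posDef_iff_det_ne_zero.2 (ha.trans_le hdet).ne'⟩, ⟨htr, hdet⟩, rfl⟩
  rw [Subtype.isCompact_iff, himg]
  have hbox : IsCompact
      (Set.univ.pi fun _ : D => Set.univ.pi fun _ : D => Set.Icc (-b) b : Set (Matrix D D ℝ)) :=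
    isCompact_univ_pi fun _ => isCompact_univ_pi fun _ => isCompact_Icc
  refine hbox.of_isClosed_subset ?_ ?_
  · have hpsd : IsClosed {W : Matrix D D ℝ | W.PosSemidef} := by
      simp only [Matrix.posSemidef_iff_dotProduct_mulVec, Set.ofPred_and, Set.ofPred_forall]
      refine IsClosed.inter ?_ (isClosed_iInter fun x => ?_)
      · exact isClosed_eq continuous_id.matrix_conjTranspose continuous_id
      · exact isClosed_le continuous_const
          (continuous_const.dotProduct (continuous_id.matrix_mulVec continuous_const))
    exact (hpsd.inter (isClosed_le continuous_id.matrix_trace continuous_const)).inter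
      (isClosed_le continuous_const continuous_id.matrix_det)
  · rintro W ⟨⟨hpsd, htr⟩, -⟩ i - j -
    exact abs_le.1 ((Matrix.PosSemidef.abs_apply_le_trace hpsd i j).trans htr)

theorem PDMatrix.continuous_inv : Continuous fun S : PDMatrix D => S.1⁻¹ := by
  refine continuous_iff_continuousAt.2 fun S => ?_
  have := continuousAt_matrix_inv S.1 (by
    rw [Ring.inverse_eq_inv']
    exact continuousAt_inv₀ S.2.det_pos.ne')
  exact this.comp continuous_subtype_val.continuousAt

theorem PDMatrix.isCompact_trace_inv_le_det_inv_ge (a b : ℝ) (ha : 0 < a) :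
    IsCompact {S : PDMatrix D | S.1⁻¹.trace ≤ b ∧ a ≤ S.1⁻¹.det} := by
  have h := (PDMatrix.isCompact_trace_le_det_ge (D := D) a b ha).image
    (f := fun W : PDMatrix D => (⟨W.1⁻¹, W.2.inv⟩ : PDMatrix D))
    (PDMatrix.continuous_inv.subtype_mk _)
  convert h using 1
  ext S
  have hinv : S.1⁻¹⁻¹ = S.1 := Matrix.nonsing_inv_nonsing_inv _ S.2.det_pos.ne'.isUnit
  constructor
  · intro hS
    exact ⟨⟨S.1⁻¹, S.2.inv⟩, hS, Subtype.ext hinv⟩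
  · rintro ⟨W, hW, rfl⟩
    simpa [Matrix.nonsing_inv_nonsing_inv _ W.2.det_pos.ne'.isUnit] using hW

end MatrixInequalities

/-- Laplace principle: if the weights are `κ ^ t * exp (-(t / 2) * G t p)` and `G t` is eventually
larger off `A` than on a set `B` of positive mass, then the normalized weights concentrate on
`A`. -/
theorem tendsto_setLIntegral_div_lintegral_of_exp {X : Type*} [MeasurableSpace X] (μ : Measure X)
    [IsProbabilityMeasure μ] {L G : ℕ → X → ℝ} {κ : ℝ} (hκ : 0 < κ)
    (hL : ∀ t p, L t p = κ ^ t * Real.exp (-(t / 2) * G t p))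
    {A B : Set X} (hA : MeasurableSet A) (hB : MeasurableSet B) (hBpos : μ B ≠ 0)
    {k g η : ℝ} (hη : 0 < η) (hk : ∀ᶠ t in atTop, ∀ᵐ p ∂μ, k ≤ G t p)
    (hGA : ∀ᶠ t in atTop, ∀ᵐ p ∂μ, p ∉ A → g + 2 * η ≤ G t p)
    (hGB : ∀ᶠ t in atTop, ∀ p ∈ B, G t p ≤ g + η) :
    Tendsto (fun t => (∫⁻ p in A, ENNReal.ofReal (L t p) ∂μ) / ∫⁻ p, ENNReal.ofReal (L t p) ∂μ)
      atTop (𝓝 1) := by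
  set N : ℕ → ℝ≥0∞ := fun t => ∫⁻ p in Aᶜ, ENNReal.ofReal (L t p) ∂μ with hN
  set T : ℕ → ℝ≥0∞ := fun t => ∫⁻ p, ENNReal.ofReal (L t p) ∂μ with hT
  have hmono : ∀ t p x, x ≤ G t p →
      ENNReal.ofReal (L t p) ≤ ENNReal.ofReal (κ ^ t * Real.exp (-(t / 2) * x)) := by
    intro t p x hx
    rw [hL]
    gcongr ENNReal.ofReal (_ * Real.exp ?_)
    exact mul_le_mul_of_nonpos_left hx (by simp; positivity)
  -- The crude bound `k` serves only to make the total mass finite.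
  have hTtop : ∀ᶠ t in atTop, T t ≠ ∞ := by
    filter_upwards [hk] with t ht
    refine ((lintegral_mono_ae (ht.mono fun p hp => hmono t p k hp)).trans_lt ?_).ne
    simp
  have hTlow : ∀ᶠ t : ℕ in atTop,
      ENNReal.ofReal (κ ^ t * Real.exp (-(t / 2) * (g + η))) * μ B ≤ T t := by
    filter_upwards [hGB] with t ht
    calc ENNReal.ofReal (κ ^ t * Real.exp (-(t / 2) * (g + η))) * μ B
        = ∫⁻ _ in B, ENNReal.ofReal (κ ^ t * Real.exp (-(t / 2) * (g + η))) ∂μ := by simp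
      _ ≤ ∫⁻ p in B, ENNReal.ofReal (L t p) ∂μ := by
          refine setLIntegral_mono' hB fun p hp => ?_
          rw [hL]
          gcongr ENNReal.ofReal (_ * Real.exp ?_)
          exact mul_le_mul_of_nonpos_left (ht p hp) (by simp; positivity)
      _ ≤ T t := setLIntegral_le_lintegral _ _
  have hNup : ∀ᶠ t : ℕ in atTop,
      N t ≤ ENNReal.ofReal (κ ^ t * Real.exp (-(t / 2) * (g + 2 * η))) := by
    filter_upwards [hGA] with t ht
    calc N t ≤ ∫⁻ _ in Aᶜ, ENNReal.ofReal (κ ^ t * Real.exp (-(t / 2) * (g + 2 * η))) ∂μ := by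
          refine setLIntegral_mono_ae' hA.compl (ht.mono fun p hp hpA => hmono t p _ (hp hpA))
      _ ≤ _ := by
          rw [setLIntegral_const]
          exact mul_le_of_le_one_right' prob_le_one
  have hquot : Tendsto (fun t => N t / T t) atTop (𝓝 0) := by
    have hlim : Tendsto (fun t : ℕ => ENNReal.ofReal (Real.exp (-(t / 2) * η)) / μ B) atTop
        (𝓝 0) := by
      have h1 : Tendsto (fun t : ℕ => Real.exp (-(t / 2) * η)) atTop (𝓝 0) := by
        refine Real.tendsto_exp_atBot.comp ?_
        have : (fun t : ℕ => -((t : ℝ) / 2) * η) = fun t : ℕ => (-(η / 2)) * (t : ℝ) := by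
          funext t; ring
        rw [this]
        exact tendsto_natCast_atTop_atTop.const_mul_atTop_of_neg (by linarith)
      have h2 := ENNReal.Tendsto.div_const (ENNReal.tendsto_ofReal h1) (b := μ B)
        (Or.inr hBpos)
      simpa using h2
    refine tendsto_of_tendsto_of_tendsto_of_le_of_le' tendsto_const_nhds hlim
      (Eventually.of_forall fun _ => zero_le) ?_
    filter_upwards [hTlow, hNup] with t h1 h2
    -- The two exponents differ by `η`, which leaves a factor decaying exponentially in `t`.
    have hsplit : κ ^ t * Real.exp (-(t / 2) * (g + 2 * η)) =
        κ ^ t * Real.exp (-(t / 2) * (g + η)) * Real.exp (-(t / 2) * η) := by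
      rw [mul_assoc, ← Real.exp_add]; ring_nf
    have hpos : 0 < κ ^ t * Real.exp (-(t / 2) * (g + η)) := by positivity
    calc N t / T t ≤ ENNReal.ofReal (κ ^ t * Real.exp (-(t / 2) * (g + 2 * η))) /
          (ENNReal.ofReal (κ ^ t * Real.exp (-(t / 2) * (g + η))) * μ B) :=
          ENNReal.div_le_div h2 h1
      _ = ENNReal.ofReal (Real.exp (-(t / 2) * η)) / μ B := by
          rw [hsplit, ENNReal.ofReal_mul hpos.le]
          exact ENNReal.mul_div_mul_left _ _ (ENNReal.ofReal_pos.2 hpos).ne'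
            ENNReal.ofReal_ne_top
  have hsub : Tendsto (fun t => 1 - N t / T t) atTop (𝓝 1) := by
    simpa using ENNReal.Tendsto.sub (tendsto_const_nhds (x := (1 : ℝ≥0∞))) hquot
      (Or.inl ENNReal.one_ne_top)
  refine hsub.congr' ?_
  filter_upwards [hTtop, hTlow] with t h1 h2
  have hT0 : T t ≠ 0 := by
    refine (lt_of_lt_of_le ?_ h2).ne'
    exact ENNReal.mul_pos (ENNReal.ofReal_pos.2 (by positivity)).ne' hBpos
  have hadd : (∫⁻ p in A, ENNReal.ofReal (L t p) ∂μ) / T t + N t / T t = 1 := by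
    rw [← ENNReal.add_div, hN]
    simp only
    rw [lintegral_add_compl _ hA]
    exact ENNReal.div_self hT0 h1
  refine (ENNReal.eq_sub_of_add_eq ?_ hadd).symm
  intro hinf
  rw [hinf] at hadd
  simp at hadd

/-! ### The Gaussian contrast: minimization over the covariance, and coercivity. -/

section Contrast

variable {D : Type*} [Fintype D] [DecidableEq D]

/-- Up to constants, `-2 / t` times the Gaussian log-likelihood of a sample of size `t` with
empirical covariance `V` about its mean, where `w` is the difference between the sample mean and
the mean of the model and `S` is the covariance of the model. -/
def gaussianContrast (V : Matrix D D ℝ) (w : D → ℝ) (S : Matrix D D ℝ) : ℝ :=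
  Real.log S.det + (S⁻¹ * (V + Matrix.vecMulVec w w)).trace

theorem continuous_gaussianContrast :
    Continuous fun q : (Matrix D D ℝ × (D → ℝ)) × PDMatrix D =>
      gaussianContrast q.1.1 q.1.2 q.2.1 := by
  unfold gaussianContrast
  have hS : Continuous fun q : (Matrix D D ℝ × (D → ℝ)) × PDMatrix D => q.2.1 :=
    continuous_subtype_val.comp continuous_snd
  have hw : Continuous fun q : (Matrix D D ℝ × (D → ℝ)) × PDMatrix D => q.1.2 :=
    continuous_snd.comp continuous_fst
  refine (hS.matrix_det.log fun q => q.2.2.det_pos.ne').add (Continuous.matrix_trace ?_)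
  exact (PDMatrix.continuous_inv.comp continuous_snd).matrix_mul
    ((continuous_fst.comp continuous_fst).add (hw.matrix_vecMulVec hw))

theorem Matrix.log_det_inv (S : Matrix D D ℝ) :
    Real.log S⁻¹.det = -Real.log S.det := by
  rw [Matrix.det_nonsing_inv, Ring.inverse_eq_inv', Real.log_inv]

theorem le_gaussianContrast {V S : Matrix D D ℝ} (hV : V.PosDef) (hS : S.PosDef) (w : D → ℝ) :
    Fintype.card D + Real.log V.det + Real.log (1 + w ⬝ᵥ (V⁻¹ *ᵥ w)) ≤
      gaussianContrast V w S := by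
  have h := hS.inv.log_det_mul_le (hV.add_posSemidef (Matrix.posSemidef_vecMulVec_self w))
  rw [hV.log_det_add_vecMulVec, Matrix.log_det_inv] at h
  unfold gaussianContrast
  linarith

theorem eq_of_gaussianContrast_le {V S : Matrix D D ℝ} (hV : V.PosDef) (hS : S.PosDef)
    (w : D → ℝ) (h : gaussianContrast V w S ≤
      Fintype.card D + Real.log V.det + Real.log (1 + w ⬝ᵥ (V⁻¹ *ᵥ w))) :
    S = V + Matrix.vecMulVec w w := by
  have h1 : S⁻¹ * (V + Matrix.vecMulVec w w) = 1 := by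
    apply hS.inv.mul_eq_one_of_le_log_det
      (hV.add_posSemidef (Matrix.posSemidef_vecMulVec_self w))
    rw [hV.log_det_add_vecMulVec, Matrix.log_det_inv]
    unfold gaussianContrast at h
    linarith
  have := congrArg (fun M => S * M) h1
  simp only [Matrix.mul_nonsing_inv_cancel_left _ _ hS.det_pos.ne'.isUnit, mul_one] at this
  exact this.symm

theorem gaussianContrast_self {V : Matrix D D ℝ} (hV : V.PosDef) (w : D → ℝ) :
    gaussianContrast V w (V + Matrix.vecMulVec w w) =
      Fintype.card D + Real.log V.det + Real.log (1 + w ⬝ᵥ (V⁻¹ *ᵥ w)) := by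
  have hM := hV.add_posSemidef (Matrix.posSemidef_vecMulVec_self w)
  rw [gaussianContrast, Matrix.nonsing_inv_mul _ hM.det_pos.ne'.isUnit, Matrix.trace_one,
    hV.log_det_add_vecMulVec]
  ring

/-- Allows the random `V` to be replaced by a fixed multiple of the identity in the coercivity
bounds. -/
theorem gaussianContrast_mono {V₁ V₂ S : Matrix D D ℝ} (hV : (V₂ - V₁).PosSemidef)
    (hS : S.PosDef) (w : D → ℝ) : gaussianContrast V₁ w S ≤ gaussianContrast V₂ w S := by
  have h := hS.inv.posSemidef.trace_mul_nonneg hV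
  rw [Matrix.mul_sub, Matrix.trace_sub] at h
  simp only [gaussianContrast, Matrix.mul_add, Matrix.trace_add]
  linarith

/-- The sublevel sets of the contrast at a multiple of the identity are bounded. -/
theorem bounds_of_gaussianContrast_le {c : ℝ} (hc : 0 < c) (K : ℝ) :
    ∃ a b R : ℝ, 0 < a ∧ ∀ (w : D → ℝ) (S : Matrix D D ℝ), S.PosDef →
      gaussianContrast (c • 1) w S ≤ K → S⁻¹.trace ≤ b ∧ a ≤ S⁻¹.det ∧ w ⬝ᵥ w ≤ R := by
  -- Half of `c * tr S⁻¹` pays for `log det S`, hence `c / 2`; the other half bounds the trace. The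
  -- constant `m` belongs to the bound on `w`, which uses the contrast minimized over `S`.
  set k : ℝ := Fintype.card D + Real.log ((c / 2) • (1 : Matrix D D ℝ)).det
  set m : ℝ := Fintype.card D + Real.log (c • (1 : Matrix D D ℝ)).det
  refine ⟨Real.exp (-K), 2 * (K - k) / c, c * Real.exp (K - m), Real.exp_pos _, ?_⟩
  intro w S hS hK
  have hnn := hS.inv.posSemidef.trace_mul_nonneg (Matrix.posSemidef_vecMulVec_self w)
  have hk := hS.inv.log_det_mul_le (Matrix.PosDef.one.smul (half_pos hc))
  have hm := le_gaussianContrast (Matrix.PosDef.one.smul hc) hS w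
  have htr := hS.inv.posSemidef.trace_nonneg
  have hK' := hK
  simp only [gaussianContrast, Matrix.mul_add, Matrix.trace_add, Matrix.mul_smul, mul_one,
    Matrix.trace_smul, smul_eq_mul] at hK' hk
  rw [Matrix.log_det_inv] at hk
  refine ⟨?_, ?_, ?_⟩
  · rw [le_div_iff₀ hc]
    simp only [k]
    linarith
  · rw [← Real.le_log_iff_exp_le hS.inv.det_pos, Matrix.log_det_inv]
    nlinarith
  · have hinv : (c • (1 : Matrix D D ℝ))⁻¹ = c⁻¹ • 1 := by
      apply Matrix.inv_eq_left_inv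
      simp [smul_smul, hc.ne']
    have hww : 0 ≤ w ⬝ᵥ w := by simpa using dotProduct_star_self_nonneg w
    rw [hinv, Matrix.smul_mulVec, Matrix.one_mulVec, dotProduct_smul, smul_eq_mul] at hm
    have hlog : Real.log (1 + c⁻¹ * (w ⬝ᵥ w)) ≤ K - m := by simp only [m]; linarith
    rw [Real.log_le_iff_le_exp (by positivity)] at hlog
    have : c⁻¹ * (w ⬝ᵥ w) ≤ Real.exp (K - m) := by linarith
    rwa [inv_mul_le_iff₀ hc] at this

/-- Symmetric matrices near a positive definite matrix are uniformly positive definite. -/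
theorem Matrix.PosDef.eventually_sub_smul_one {V₀ : Matrix D D ℝ} (hV₀ : V₀.PosDef) :
    ∃ c : ℝ, 0 < c ∧ ∀ᶠ V in 𝓝 V₀, V.IsHermitian → (V - c • (1 : Matrix D D ℝ)).PosSemidef := by
  have hcont : Continuous fun q : (Matrix D D ℝ × ℝ) × (D → ℝ) =>
      q.2 ⬝ᵥ ((q.1.1 - q.1.2 • (1 : Matrix D D ℝ)) *ᵥ q.2) := by
    refine continuous_snd.dotProduct (Continuous.matrix_mulVec ?_ continuous_snd)
    exact (continuous_fst.comp continuous_fst).sub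
      ((continuous_snd.comp continuous_fst).smul continuous_const)
  -- Compactness of the unit sphere makes positivity uniform in `x` for all `(V, c)` near `(V₀, 0)`;
  -- homogeneity then covers every vector.
  have hev := (isCompact_sphere (0 : D → ℝ) 1).eventually_forall_of_forall_eventually
    (x₀ := (V₀, (0 : ℝ)))
    (P := fun q x => 0 < x ⬝ᵥ ((q.1 - q.2 • (1 : Matrix D D ℝ)) *ᵥ x)) (by
      intro x hx
      refine hcont.continuousAt.eventually (lt_mem_nhds ?_)
      have hx0 : x ≠ 0 := by
        rintro rfl
        simp at hx
      simpa using hV₀.dotProduct_mulVec_pos hx0)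
  rw [nhds_prod_eq, eventually_prod_iff] at hev
  obtain ⟨pa, hpa, pb, hpb, hab⟩ := hev
  obtain ⟨c, hcb, hc⟩ := ((hpb.filter_mono nhdsWithin_le_nhds).and
    (self_mem_nhdsWithin : Set.Ioi (0 : ℝ) ∈ 𝓝[>] 0)).exists
  refine ⟨c, hc, hpa.mono fun V hV hsym => ?_⟩
  refine Matrix.PosSemidef.of_dotProduct_mulVec_nonneg
    (hsym.sub (Matrix.PosDef.one.smul hc).1) fun x => ?_
  rcases eq_or_ne x 0 with rfl | hx
  · simp
  have hn : 0 < ‖x‖ := norm_pos_iff.2 hx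
  have h := hab hV hcb (‖x‖⁻¹ • x) (by simp [norm_smul, hn.ne'])
  rw [Matrix.mulVec_smul, dotProduct_smul, smul_dotProduct, smul_eq_mul, smul_eq_mul,
    ← mul_assoc] at h
  simpa using (pos_of_mul_pos_right h (by positivity)).le

end Contrast

/-! ### Sample moments, the likelihood, and concentration of the posteriors. -/

section Concentration

/-- The mean of the first `t` vectors. -/
def sampleMean {D : Type*} (e : ℕ → D → ℝ) (t : ℕ) : D → ℝ :=
  (t : ℝ)⁻¹ • ∑ z ∈ Finset.range t, e z

/-- The empirical covariance of the first `t` vectors. -/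
def sampleCov {D : Type*} (e : ℕ → D → ℝ) (t : ℕ) : Matrix D D ℝ :=
  (t : ℝ)⁻¹ • ∑ z ∈ Finset.range t, Matrix.vecMulVec (e z) (e z) -
    Matrix.vecMulVec (sampleMean e t) (sampleMean e t)

theorem isHermitian_sampleCov {D : Type*} (e : ℕ → D → ℝ) (t : ℕ) :
    (sampleCov e t).IsHermitian := by
  ext x y
  simp [sampleCov, Matrix.sum_apply, Matrix.vecMulVec_apply, mul_comm]

theorem sum_vecMulVec_add_eq {D : Type*} (e : ℕ → D → ℝ) (w : D → ℝ) (t : ℕ) :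
    ∑ z ∈ Finset.range t, Matrix.vecMulVec (e z + w) (e z + w) =
      (t : ℝ) • (sampleCov e t + Matrix.vecMulVec (w + sampleMean e t) (w + sampleMean e t)) := by
  rcases Nat.eq_zero_or_pos t with rfl | ht
  · simp
  have ht' : (t : ℝ) ≠ 0 := by positivity
  ext x y
  simp only [sampleCov, sampleMean, Matrix.sum_apply, Matrix.vecMulVec_apply, Matrix.smul_apply,
    Matrix.add_apply, Matrix.sub_apply, Pi.add_apply, Pi.smul_apply, Finset.sum_apply,
    smul_eq_mul, add_mul, mul_add, Finset.sum_add_distrib, Finset.sum_const, Finset.card_range,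
    nsmul_eq_mul, ← Finset.sum_mul, ← Finset.mul_sum]
  field_simp
  ring

theorem tendsto_sampleCov {D : Type*} {e : ℕ → D → ℝ} {V₀ : Matrix D D ℝ}
    (hmean : Tendsto (sampleMean e) atTop (𝓝 0))
    (hsq : ∀ x y, Tendsto (fun t : ℕ => (∑ z ∈ Finset.range t, e z x * e z y) / t) atTop
      (𝓝 (V₀ x y))) :
    Tendsto (sampleCov e) atTop (𝓝 V₀) := by
  refine tendsto_pi_nhds.2 fun x => tendsto_pi_nhds.2 fun y => ?_
  have hx := (tendsto_pi_nhds.1 hmean x).mul (tendsto_pi_nhds.1 hmean y)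
  have h := (hsq x y).sub hx
  simp only [Pi.zero_apply, mul_zero, sub_zero] at h
  refine h.congr fun t => ?_
  simp [sampleCov, Matrix.sum_apply, Matrix.vecMulVec_apply, div_eq_inv_mul]

variable {D : Type*} [Fintype D] [DecidableEq D]

theorem gaussianDensity_eq_exp {S : Matrix D D ℝ} (hS : S.PosDef) (m x : D → ℝ) :
    gaussianDensity m S x = (Real.sqrt ((2 * Real.pi) ^ Fintype.card D))⁻¹ *
      Real.exp (-(1 / 2) *
        (Real.log S.det + (S⁻¹ * Matrix.vecMulVec (x - m) (x - m)).trace)) := by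
  have htr : (S⁻¹ * Matrix.vecMulVec (x - m) (x - m)).trace = (x - m) ⬝ᵥ (S⁻¹ *ᵥ (x - m)) := by
    rw [Matrix.mul_vecMulVec, Matrix.trace_vecMulVec, dotProduct_comm]
  have hdet : (Real.sqrt S.det)⁻¹ = Real.exp (-(1 / 2) * Real.log S.det) := by
    rw [Real.sqrt_eq_rpow, ← Real.rpow_neg hS.det_pos.le, Real.rpow_def_of_pos hS.det_pos]
    ring_nf
  rw [gaussianDensity, htr, Real.sqrt_mul (by positivity), mul_inv, hdet, mul_add, Real.exp_add,
    mul_assoc]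

/-- The sample mean and covariance are sufficient statistics: centring the squares at the sample
mean puts the likelihood in the form required by the Laplace principle. -/
theorem likelihood_eq_exp {F : Type*} (mean : F → D → ℝ) (r e : ℕ → D → ℝ) (m₀ : D → ℝ)
    (hr : ∀ t, r t = m₀ + e t) (t : ℕ) (p : F × PDMatrix D) :
    likelihood mean r t p = (Real.sqrt ((2 * Real.pi) ^ Fintype.card D))⁻¹ ^ t *
      Real.exp (-(t / 2) *
        gaussianContrast (sampleCov e t) (m₀ - mean p.1 + sampleMean e t) p.2.1) := by
  have hterm : ∀ z, r z - mean p.1 = e z + (m₀ - mean p.1) := fun z => by rw [hr]; abel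
  simp only [likelihood, gaussianDensity_eq_exp p.2.2, Finset.prod_mul_distrib,
    Finset.prod_const, Finset.card_range, ← Real.exp_sum, ← Finset.mul_sum,
    Finset.sum_add_distrib, Finset.sum_const, hterm, ← Matrix.trace_sum]
  rw [sum_vecMulVec_add_eq, gaussianContrast]
  simp only [Matrix.mul_smul, Matrix.trace_smul, smul_eq_mul, nsmul_eq_mul]
  ring_nf

/-- If the sample moments of the errors converge, the posteriors of an agent whose prior has
support inside `{p | p.1 ∈ C}` concentrate on the unique point of the support that minimizes the
limiting contrast. -/
theorem concentratesOn_of_tendsto {F : Type*} [TopologicalSpace F] [MeasurableSpace F]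
    [OpensMeasurableSpace (F × PDMatrix D)] (P₀ : Measure (F × PDMatrix D))
    [IsProbabilityMeasure P₀] {C : Set F} (hC : ∀ᵐ p ∂P₀, p.1 ∈ C)
    {mean : F → D → ℝ} (hmean : Continuous mean) (m₀ : D → ℝ)
    (hcomp : ∀ R : ℝ, IsCompact {f ∈ C | ∀ x, |m₀ x - mean f x| ≤ R})
    {V₀ : Matrix D D ℝ} (hV₀ : V₀.PosDef) {f₀ : F}
    (hmin : ∀ f ∈ C, f ≠ f₀ → (m₀ - mean f₀) ⬝ᵥ (V₀⁻¹ *ᵥ (m₀ - mean f₀)) <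
      (m₀ - mean f) ⬝ᵥ (V₀⁻¹ *ᵥ (m₀ - mean f)))
    {S₀ : PDMatrix D} (hS₀ : S₀.1 = V₀ + Matrix.vecMulVec (m₀ - mean f₀) (m₀ - mean f₀))
    (hsupp : (f₀, S₀) ∈ P₀.support)
    {r e : ℕ → D → ℝ} (hr : ∀ t, r t = m₀ + e t)
    (hlim_mean : Tendsto (sampleMean e) atTop (𝓝 0))
    (hlim_cov : Tendsto (sampleCov e) atTop (𝓝 V₀)) :
    ConcentratesOn P₀ mean r (f₀, S₀) := by
  intro A hA hpA
  -- the contrast as a function of the sample moments and the parameter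
  let Γ : (Matrix D D ℝ × (D → ℝ)) × (F × PDMatrix D) → ℝ := fun q =>
    gaussianContrast q.1.1 (m₀ - mean q.2.1 + q.1.2) q.2.2.1
  have hΓ : Continuous Γ := by
    refine continuous_gaussianContrast.comp
      (f := fun q : (Matrix D D ℝ × (D → ℝ)) × (F × PDMatrix D) =>
        ((q.1.1, m₀ - mean q.2.1 + q.1.2), q.2.2)) ?_
    have := hmean.comp (continuous_fst.comp
      (continuous_snd (X := Matrix D D ℝ × (D → ℝ)) (Y := F × PDMatrix D)))
    fun_prop
  let y : ℕ → Matrix D D ℝ × (D → ℝ) := fun t => (sampleCov e t, sampleMean e t)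
  let y₀ : Matrix D D ℝ × (D → ℝ) := (V₀, 0)
  have hy : Tendsto y atTop (𝓝 y₀) := hlim_cov.prodMk_nhds hlim_mean
  set p₀ : F × PDMatrix D := (f₀, S₀)
  set g : ℝ := Γ (y₀, p₀) with hg
  -- With `f = f₀` the equality case determines `S`; otherwise `hmin` and monotonicity of the
  -- logarithm give the strict inequality.
  have hstrict : ∀ p : F × PDMatrix D, p.1 ∈ C → p ≠ p₀ → g < Γ (y₀, p) := by
    rintro ⟨f, S⟩ hf hne
    have hg' : g = Fintype.card D + Real.log V₀.det +
        Real.log (1 + (m₀ - mean f₀) ⬝ᵥ (V₀⁻¹ *ᵥ (m₀ - mean f₀))) := by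
      simp only [hg, Γ, y₀, p₀, add_zero, hS₀]
      exact gaussianContrast_self hV₀ _
    have hΓ' : Γ (y₀, (f, S)) = gaussianContrast V₀ (m₀ - mean f) S.1 := by simp [Γ, y₀]
    have hlow := le_gaussianContrast hV₀ S.2 (m₀ - mean f)
    rw [hg', hΓ']
    by_cases hff : f = f₀
    · subst hff
      refine lt_of_le_of_ne hlow fun heq => hne ?_
      have := eq_of_gaussianContrast_le hV₀ S.2 _ heq.ge
      exact Prod.ext rfl (Subtype.ext (this.trans hS₀.symm))
    · have h0 : 0 ≤ (m₀ - mean f₀) ⬝ᵥ (V₀⁻¹ *ᵥ (m₀ - mean f₀)) := by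
        simpa using hV₀.inv.posSemidef.dotProduct_mulVec_nonneg (m₀ - mean f₀)
      have := Real.log_lt_log (by positivity) (add_lt_add_right (hmin f hf hff) 1)
      linarith
  obtain ⟨c, hc, hcev⟩ := hV₀.eventually_sub_smul_one
  have hcev' : ∀ᶠ t in atTop, ∀ p : F × PDMatrix D,
      gaussianContrast (c • 1) (m₀ - mean p.1 + sampleMean e t) p.2.1 ≤ Γ (y t, p) :=
    (hlim_cov.eventually hcev).mono fun t ht p =>
      gaussianContrast_mono (ht (isHermitian_sampleCov e t)) p.2.2 _
  -- a compact set off which the contrast is large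
  obtain ⟨a, b, R, ha, habR⟩ := bounds_of_gaussianContrast_le (D := D) hc (g + 2)
  -- The added `1` absorbs the sample mean of the errors. The level `g + 2` suffices because the gap
  -- `2 * η` will be taken with `η ≤ 1`.
  let Q : Set (F × PDMatrix D) := {f ∈ C | ∀ x, |m₀ x - mean f x| ≤ Real.sqrt R + 1} ×ˢ
    {S : PDMatrix D | S.1⁻¹.trace ≤ b ∧ a ≤ S.1⁻¹.det}
  have hQ : IsCompact Q := (hcomp _).prod (PDMatrix.isCompact_trace_inv_le_det_inv_ge a b ha)
  have hsmall : ∀ᶠ t in atTop, ∀ x, |sampleMean e t x| ≤ 1 := by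
    refine eventually_all.2 fun x => ?_
    have h := (tendsto_pi_nhds.1 hlim_mean x).abs
    simp only [Pi.zero_apply, abs_zero] at h
    exact (h.eventually (gt_mem_nhds one_pos)).mono fun t ht => ht.le
  have hout : ∀ᶠ t in atTop, ∀ p : F × PDMatrix D, p.1 ∈ C → Γ (y t, p) ≤ g + 2 → p ∈ Q := by
    filter_upwards [hcev', hsmall] with t h1 h2 p hp hle
    obtain ⟨htr, hdet, hw⟩ := habR _ _ p.2.2 ((h1 p).trans hle)
    refine ⟨⟨hp, fun x => ?_⟩, htr, hdet⟩
    have hx : (m₀ x - mean p.1 x + sampleMean e t x) ^ 2 ≤ R := by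
      refine le_trans ?_ hw
      rw [sq]
      exact Finset.single_le_sum
        (f := fun x => (m₀ - mean p.1 + sampleMean e t) x * (m₀ - mean p.1 + sampleMean e t) x)
        (fun x _ => mul_self_nonneg _) (Finset.mem_univ x)
    have h3 := abs_le.1 (Real.abs_le_sqrt hx)
    have h4 := abs_le.1 (h2 x)
    rw [abs_le]
    constructor <;> linarith [h3.1, h3.2, h4.1, h4.2]
  -- a uniform gap on the compact set, off `A`
  obtain ⟨η, hη, hη1, hgap⟩ : ∃ η : ℝ, 0 < η ∧ η ≤ 1 ∧ ∀ p ∈ Q \ A, g + 2 * η < Γ (y₀, p) := by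
    rcases (Q \ A).eq_empty_or_nonempty with hempty | hne
    · exact ⟨1, one_pos, le_rfl, by simp [hempty]⟩
    · obtain ⟨p₁, hp₁, hp₁min⟩ := (hQ.diff hA).exists_isMinOn hne
        (hΓ.comp (Continuous.prodMk_right y₀)).continuousOn
      have hlt : g < Γ (y₀, p₁) :=
        hstrict p₁ hp₁.1.1.1 fun h => hp₁.2 (h ▸ hpA)
      -- A quarter of the gap, so that `g + 2 * η` stays strictly below the minimum on `Q \ A`.
      refine ⟨min 1 ((Γ (y₀, p₁) - g) / 4), lt_min one_pos (by linarith), min_le_left _ _, ?_⟩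
      intro p hp
      have h1 : Γ (y₀, p₁) ≤ Γ (y₀, p) := hp₁min hp
      linarith [min_le_right 1 ((Γ (y₀, p₁) - g) / 4)]
  have hGA : ∀ᶠ t in atTop, ∀ᵐ p ∂P₀, p ∉ A → g + 2 * η ≤ Γ (y t, p) := by
    -- Compactness of `Q \ A` carries the strict gap at the limit moments `y₀` over to all nearby
    -- moments, uniformly in the parameter.
    have h := hy.eventually ((hQ.diff hA).eventually_forall_of_forall_eventually
      (P := fun y p => g + 2 * η < Γ (y, p)) fun p hp =>
        hΓ.continuousAt.eventually (lt_mem_nhds (hgap p hp)))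
    filter_upwards [h, hout] with t h1 h2
    filter_upwards [hC] with p hp hpA'
    by_contra! hlt
    have hpQ := h2 p hp (by linarith)
    exact absurd (h1 p ⟨hpQ, hpA'⟩) (not_lt.2 hlt.le)
  have hk : ∀ᶠ t in atTop, ∀ᵐ p ∂P₀,
      (Fintype.card D : ℝ) + Real.log (c • (1 : Matrix D D ℝ)).det ≤ Γ (y t, p) := by
    filter_upwards [hcev'] with t ht
    refine Eventually.of_forall fun p => le_trans ?_ (ht p)
    have hcp : (c • (1 : Matrix D D ℝ)).PosDef := Matrix.PosDef.one.smul hc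
    refine le_trans ?_ (le_gaussianContrast hcp p.2.2 _)
    have h0 := hcp.inv.posSemidef.dotProduct_mulVec_nonneg (m₀ - mean p.1 + sampleMean e t)
    simp only [star_trivial] at h0
    have := Real.log_nonneg (le_add_of_nonneg_right h0)
    linarith
  -- a neighbourhood of the minimizer on which the contrast is small
  have hnear : ∀ᶠ q : (Matrix D D ℝ × (D → ℝ)) × (F × PDMatrix D) in 𝓝 y₀ ×ˢ 𝓝 p₀,
      Γ q < g + η := by
    rw [← nhds_prod_eq]
    exact hΓ.continuousAt.eventually (gt_mem_nhds (by linarith))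
  obtain ⟨pa, hpa, pb, hpb, hab⟩ := eventually_prod_iff.1 hnear
  obtain ⟨B, hBsub, hBopen, hBmem⟩ := mem_nhds_iff.1 hpb
  -- Here the agnostic prior enters: neighbourhoods of the minimizer carry positive mass.
  have hBpos : P₀ B ≠ 0 :=
    ((Measure.mem_support_iff_forall _).1 hsupp B (hBopen.mem_nhds hBmem)).ne'
  have hGB : ∀ᶠ t in atTop, ∀ p ∈ B, Γ (y t, p) ≤ g + η :=
    (hy.eventually hpa).mono fun t ht p hp => (hab ht (hBsub hp)).le
  exact tendsto_setLIntegral_div_lintegral_of_exp P₀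
    (κ := (Real.sqrt ((2 * Real.pi) ^ Fintype.card D))⁻¹) (by positivity)
    (fun t p => likelihood_eq_exp mean r e m₀ hr t p) hA.measurableSet hBopen.measurableSet hBpos
    hη hk hGA hGB

end Concentration

/-! ### Almost sure convergence of the sample moments. -/

section StrongLaw

/-- Strong law of large numbers for the first and second moments of independent centred Gaussian
errors. -/
theorem ae_tendsto_sampleMean_sampleCov {Ω D : Type*} [MeasurableSpace Ω] (P : Measure Ω)
    [IsProbabilityMeasure P] [Fintype D] [DecidableEq D] (ε : ℕ → D → Ω → ℝ) (v : D → ℝ≥0)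
    (hlaw : ∀ t x, HasLaw (ε t x) (gaussianReal 0 (v x)) P)
    (hindep : iIndepFun (fun tx : ℕ × D => ε tx.1 tx.2) P) :
    ∀ᵐ ω ∂P, Tendsto (sampleMean fun t x => ε t x ω) atTop (𝓝 0) ∧
      Tendsto (sampleCov fun t x => ε t x ω) atTop (𝓝 (Matrix.diagonal fun x => (v x : ℝ))) := by
  have hmem : ∀ t x, MemLp (ε t x) 2 P := fun t x => by
    have h := (memLp_id_gaussianReal (μ := 0) (v := v x) 2)
    rw [← (hlaw t x).map_eq] at h
    exact h.comp_of_map (hlaw t x).aemeasurable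
  have hzero : ∀ t x, ∫ ω, ε t x ω ∂P = 0 := fun t x => by
    rw [(hlaw t x).integral_eq, integral_id_gaussianReal]
  have hmean : ∀ᵐ ω ∂P, ∀ x, Tendsto (fun n : ℕ => (∑ t ∈ Finset.range n, ε t x ω) / n) atTop
      (𝓝 0) := by
    refine ae_all_iff.2 fun x => ?_
    have h := strong_law_ae_real (μ := P) (fun t => ε t x) ((hmem 0 x).integrable (by norm_num))
      (fun s t hst => hindep.indepFun (i := (s, x)) (j := (t, x)) (by simp [hst]))
      (fun t => (hlaw t x).identDistrib (hlaw 0 x))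
    rwa [hzero] at h
  have hsq : ∀ᵐ ω ∂P, ∀ x y,
      Tendsto (fun n : ℕ => (∑ t ∈ Finset.range n, ε t x ω * ε t y ω) / n) atTop
        (𝓝 (Matrix.diagonal (fun x => (v x : ℝ)) x y)) := by
    refine ae_all_iff.2 fun x => ae_all_iff.2 fun y => ?_
    -- On the diagonal this is the square of identically distributed errors; off the diagonal
    -- independence within a period determines the law of the product.
    have hid : ∀ t, IdentDistrib (fun ω => ε t x ω * ε t y ω) (fun ω => ε 0 x ω * ε 0 y ω) P P := by
      intro t
      rcases eq_or_ne x y with rfl | hxy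
      · exact ((hlaw t x).identDistrib (hlaw 0 x)).comp (measurable_id.mul measurable_id)
      · have hxy' : ∀ s, ε s x ⟂ᵢ[P] ε s y := fun s =>
          hindep.indepFun (i := (s, x)) (j := (s, y)) (by simp [hxy])
        exact ((hxy' t).hasLaw_fun_mul (hlaw t x) (hlaw t y)).identDistrib
          ((hxy' 0).hasLaw_fun_mul (hlaw 0 x) (hlaw 0 y))
    have h := strong_law_ae_real (μ := P) (fun t ω => ε t x ω * ε t y ω)
      ((hmem 0 x).integrable_mul (hmem 0 y))
      (fun s t hst => (hindep.indepFun_prodMk_prodMk₀ (fun tx => (hlaw tx.1 tx.2).aemeasurable)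
        (s, x) (s, y) (t, x) (t, y) (by simp [hst]) (by simp [hst]) (by simp [hst])
        (by simp [hst])).comp (φ := fun q : ℝ × ℝ => q.1 * q.2)
          (ψ := fun q : ℝ × ℝ => q.1 * q.2) (by fun_prop) (by fun_prop)) hid
    have hint : ∫ ω, ε 0 x ω * ε 0 y ω ∂P = Matrix.diagonal (fun x => (v x : ℝ)) x y := by
      rcases eq_or_ne x y with rfl | hxy
      · have hv := (hlaw 0 x).variance_eq
        rw [variance_id_gaussianReal, variance_of_integral_eq_zero (hlaw 0 x).aemeasurable
          (hzero 0 x)] at hv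
        simp [← hv, sq]
      · rw [(hindep.indepFun (i := (0, x)) (j := (0, y))
          (by simp [hxy])).integral_fun_mul_eq_mul_integral
            (hmem 0 x).aestronglyMeasurable (hmem 0 y).aestronglyMeasurable, hzero 0 x]
        simp [hxy]
    rwa [hint] at h
  filter_upwards [hmean, hsq] with ω h1 h2
  have hlim : Tendsto (sampleMean fun t x => ε t x ω) atTop (𝓝 0) := by
    refine tendsto_pi_nhds.2 fun x => (h1 x).congr fun t => ?_
    simp [sampleMean, div_eq_inv_mul]
  exact ⟨hlim, tendsto_sampleCov hlim h2⟩

end StrongLaw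

/-! ### Weighted least squares with the agent's own caliber fixed. -/

section LeastSquares

theorem SignalIdx.sum_eq {I : ℕ} (h : SignalIdx I → ℝ) :
    ∑ x, h x = ∑ j, h (.recognition j) + h .discrimination + ∑ j, h (.caliber j) := by
  let e : (Fin I ⊕ Unit) ⊕ Fin I ≃ SignalIdx I :=
    { toFun := Sum.elim (Sum.elim .recognition fun _ => .discrimination) .caliber
      invFun := fun x => match x with
        | .recognition j => .inl (.inl j)
        | .discrimination => .inl (.inr ())
        | .caliber j => .inr j
      left_inv := by rintro ((j | _) | j) <;> rfl
      right_inv := by rintro (j | _ | j) <;> rfl }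
  rw [← e.sum_comp]
  simp [e]

/-- Weighted least squares with one coordinate held fixed: first-order conditions characterize
the strict minimum. -/
theorem weightedSquares_lt {I : ℕ} {i : Fin I} {c : Fin I → ℝ} {vq vη va : ℝ} (hvq : 0 < vq)
    (hvη : 0 < vη) (hva : 0 < va) {b₀ b : Fin I → ℝ} {τ₀ τ : ℝ} (hi : b i = b₀ i)
    (hb₀ : ∀ j, j ≠ i → (b₀ j + c j * τ₀) / vq + b₀ j / va = 0)
    (hτ₀ : ∑ j, c j * (b₀ j + c j * τ₀) / vq + τ₀ / vη = 0) (hne : (b, τ) ≠ (b₀, τ₀)) :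
    ∑ j, (b₀ j + c j * τ₀) ^ 2 / vq + τ₀ ^ 2 / vη + ∑ j, b₀ j ^ 2 / va <
      ∑ j, (b j + c j * τ) ^ 2 / vq + τ ^ 2 / vη + ∑ j, b j ^ 2 / va := by
  -- No first-order condition is needed at `i`, since that coordinate cannot vary.
  have hcross : ∑ j, (b j - b₀ j) * ((b₀ j + c j * τ₀) / vq + b₀ j / va) = 0 := by
    refine Finset.sum_eq_zero fun j _ => ?_
    rcases eq_or_ne j i with rfl | hj
    · rw [hi]; ring
    · rw [hb₀ j hj, mul_zero]
  -- The objective is quadratic, so its second-order expansion about `(b₀, τ₀)` is exact; only the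
  -- positive quadratic part survives.
  have hexpand : ∑ j, (b j + c j * τ) ^ 2 / vq + τ ^ 2 / vη + ∑ j, b j ^ 2 / va =
      ∑ j, (b₀ j + c j * τ₀) ^ 2 / vq + τ₀ ^ 2 / vη + ∑ j, b₀ j ^ 2 / va +
      2 * ∑ j, (b j - b₀ j) * ((b₀ j + c j * τ₀) / vq + b₀ j / va) +
      2 * (τ - τ₀) * (∑ j, c j * (b₀ j + c j * τ₀) / vq + τ₀ / vη) +
      (∑ j, ((b j - b₀ j) + c j * (τ - τ₀)) ^ 2 / vq + (τ - τ₀) ^ 2 / vη +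
        ∑ j, (b j - b₀ j) ^ 2 / va) := by
    have : ∀ j, (b j + c j * τ) ^ 2 / vq + b j ^ 2 / va =
        (b₀ j + c j * τ₀) ^ 2 / vq + b₀ j ^ 2 / va +
        2 * ((b j - b₀ j) * ((b₀ j + c j * τ₀) / vq + b₀ j / va)) +
        2 * (τ - τ₀) * (c j * (b₀ j + c j * τ₀) / vq) +
        (((b j - b₀ j) + c j * (τ - τ₀)) ^ 2 / vq + (b j - b₀ j) ^ 2 / va) := fun j => by ring
    have hsum := Finset.sum_congr (rfl : (Finset.univ : Finset (Fin I)) = Finset.univ)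
      fun j _ => this j
    simp only [Finset.sum_add_distrib, ← Finset.mul_sum] at hsum
    have hτ : τ ^ 2 / vη = τ₀ ^ 2 / vη + 2 * (τ - τ₀) * (τ₀ / vη) + (τ - τ₀) ^ 2 / vη := by ring
    linear_combination hsum + hτ
  rw [hexpand, hcross, hτ₀]
  have h1 : 0 ≤ ∑ j, ((b j - b₀ j) + c j * (τ - τ₀)) ^ 2 / vq :=
    Finset.sum_nonneg fun j _ => by positivity
  have h2 : 0 ≤ (τ - τ₀) ^ 2 / vη := by positivity
  have h3 : 0 ≤ ∑ j, (b j - b₀ j) ^ 2 / va := Finset.sum_nonneg fun j _ => by positivity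
  have hpos : 0 < (τ - τ₀) ^ 2 / vη + ∑ j, (b j - b₀ j) ^ 2 / va := by
    by_cases hτ : τ = τ₀
    · have : ∃ j, b j ≠ b₀ j := by
        by_contra! hb
        exact hne (Prod.ext (funext hb) hτ)
      obtain ⟨j, hj⟩ := this
      have hj' := sub_ne_zero.2 hj
      refine add_pos_of_nonneg_of_pos h2 (Finset.sum_pos' (fun j _ => by positivity)
        ⟨j, Finset.mem_univ j, by positivity⟩)
    · have hτ' := sub_ne_zero.2 hτ
      exact add_pos_of_pos_of_nonneg (by positivity) h3
  linarith

/-- The first-order conditions at the long-run bias, for overconfidence `Δ`. -/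
theorem longRunBias_foc {I : ℕ} {i : Fin I} {c : Fin I → ℝ} (hc : ∀ j, c j = 1 ∨ c j = -1)
    {vq vη va : ℝ} (hvq : 0 < vq) (hvη : 0 < vη) (hva : 0 < va) {Δ k τ₀ : ℝ} {b₀ : Fin I → ℝ}
    (hk : k = ((vq + vη) * (vq + va) + ((I : ℝ) - 1) * vq * vη))
    (hτ₀ : τ₀ = vη * (vq + va) * c i / k * Δ) (hi : b₀ i = -Δ)
    (hb₀ : ∀ j, j ≠ i → b₀ j = -(vη * va * c i * c j / k * Δ)) :
    (∀ j, j ≠ i → (b₀ j + c j * τ₀) / vq + b₀ j / va = 0) ∧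
      ∑ j, c j * (b₀ j + c j * τ₀) / vq + τ₀ / vη = 0 := by
  have hsq : ∀ j, c j ^ 2 = 1 := fun j => by rcases hc j with h | h <;> simp [h]
  have hI : 1 ≤ I := Nat.one_le_iff_ne_zero.2 fun h => by subst h; exact i.elim0
  have hI' : (0 : ℝ) ≤ (I : ℝ) - 1 := by
    have : (1 : ℝ) ≤ I := by exact_mod_cast hI
    linarith
  have hkpos : 0 < k := by rw [hk]; positivity
  refine ⟨fun j hj => ?_, ?_⟩
  · rw [hb₀ j hj, hτ₀]
    field_simp
    ring
  · rw [← Finset.add_sum_erase _ _ (Finset.mem_univ i)]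
    -- Since `c j ^ 2 = 1`, every `j ≠ i` contributes the same amount; this is the source of the
    -- factor `I - 1` in `k`. Here `b₀` and `τ₀` are truth minus belief, so the signs are opposite
    -- to the biases.
    have hterm : ∀ j ∈ Finset.univ.erase i,
        c j * (b₀ j + c j * τ₀) / vq = vη * c i * Δ / k := by
      intro j hj
      rw [hb₀ j (Finset.ne_of_mem_erase hj), hτ₀]
      field_simp
      linear_combination (vq * c i * Δ) * hsq j
    rw [Finset.sum_congr rfl hterm, Finset.sum_const, Finset.card_erase_of_mem (Finset.mem_univ i),
      Finset.card_univ, Fintype.card_fin, nsmul_eq_mul, Nat.cast_sub hI, Nat.cast_one, hi, hτ₀]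
    field_simp
    rw [hsq i, hk]
    ring

end LeastSquares

/-! ### Specialization to the one-group model. -/

section OneGroup

/-- Needed for open sets of parameters to be measurable in the product and for the support of the
prior to have full measure. -/
instance PDMatrix.instSecondCountableTopology (D : Type*) [Fintype D] :
    SecondCountableTopology (PDMatrix D) :=
  haveI : SecondCountableTopology (Matrix D D ℝ) :=
    inferInstanceAs (SecondCountableTopology (D → D → ℝ))
  TopologicalSpace.Subtype.secondCountableTopology _

theorem continuous_meanSignal {I : ℕ} (c : Fin I → ℝ) : Continuous (meanSignal c) := by
  refine continuous_pi fun x => ?_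
  cases x <;> simp only [meanSignal] <;> fun_prop

/-- The caliber and discrimination signals reveal `a` and `θ` separately, so a bounded misfit of the
means confines the fundamentals to a box. -/
theorem isCompact_setOf_abs_sub_meanSignal_le {I : ℕ} (i : Fin I) (c : Fin I → ℝ)
    (f₁ : Fundamentals I) (a R : ℝ) :
    IsCompact {f ∈ {f : Fundamentals I | f.1 i = a} |
      ∀ x, |meanSignal c f₁ x - meanSignal c f x| ≤ R} := by
  have hbox : IsCompact ((Set.univ.pi fun j => Set.Icc (f₁.1 j - R) (f₁.1 j + R)) ×ˢ
      Set.Icc (f₁.2 - R) (f₁.2 + R) : Set (Fundamentals I)) :=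
    (isCompact_univ_pi fun _ => isCompact_Icc).prod isCompact_Icc
  refine hbox.of_isClosed_subset ?_ ?_
  · have hcl : IsClosed {f | ∀ x, |meanSignal c f₁ x - meanSignal c f x| ≤ R} := by
      simp only [Set.ofPred_forall]
      exact isClosed_iInter fun x => isClosed_le
        (continuous_const.sub ((continuous_apply x).comp (continuous_meanSignal c))).abs
        continuous_const
    exact (isClosed_eq (f := fun f : Fundamentals I => f.1 i) (by fun_prop)
      continuous_const).inter hcl
  · rintro f ⟨-, hf⟩
    refine ⟨fun j _ => ?_, ?_⟩
    · have h := abs_le.1 (hf (.caliber j))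
      simp only [meanSignal] at h
      constructor <;> linarith [h.1, h.2]
    · have h := abs_le.1 (hf .discrimination)
      simp only [meanSignal] at h
      constructor <;> linarith [h.1, h.2]

theorem posDef_diagonal_errorVariance {I : ℕ} {vq vη va : ℝ≥0} (hvq : 0 < vq) (hvη : 0 < vη)
    (hva : 0 < va) :
    (Matrix.diagonal fun x : SignalIdx I => (errorVariance vq vη va x : ℝ)).PosDef := by
  refine Matrix.PosDef.diagonal fun x => ?_
  cases x <;> simpa [errorVariance]

theorem dotProduct_inv_diagonal_errorVariance {I : ℕ} {vq vη va : ℝ≥0} (hvq : 0 < vq)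
    (hvη : 0 < vη) (hva : 0 < va) (c : Fin I → ℝ) (f₁ f : Fundamentals I) :
    (meanSignal c f₁ - meanSignal c f) ⬝ᵥ
      ((Matrix.diagonal fun x : SignalIdx I => (errorVariance vq vη va x : ℝ))⁻¹ *ᵥ
        (meanSignal c f₁ - meanSignal c f)) =
      ∑ j, ((f₁.1 j - f.1 j) + c j * (f₁.2 - f.2)) ^ 2 / vq + (f₁.2 - f.2) ^ 2 / vη +
        ∑ j, (f₁.1 j - f.1 j) ^ 2 / va := by
  have hinv : (Matrix.diagonal fun x : SignalIdx I => (errorVariance vq vη va x : ℝ))⁻¹ =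
      Matrix.diagonal fun x => (errorVariance vq vη va x : ℝ)⁻¹ := by
    apply Matrix.inv_eq_left_inv
    rw [Matrix.diagonal_mul_diagonal, ← Matrix.diagonal_one]
    congr 1
    funext x
    cases x <;> simp [errorVariance, hvq.ne', hvη.ne', hva.ne']
  rw [hinv, dotProduct, SignalIdx.sum_eq]
  simp only [Matrix.mulVec_diagonal, Pi.sub_apply, meanSignal, errorVariance]
  congr 1
  · congr 1
    · exact Finset.sum_congr rfl fun j _ => by ring
    · ring
  · exact Finset.sum_congr rfl fun j _ => by ring

/-- The fundamentals on which the beliefs of agent `i` concentrate. -/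
def longRunFundamentals {I : ℕ} (i : Fin I) (c A : Fin I → ℝ) (Θ : ℝ) (vq vη va : ℝ≥0)
    (aTilde : ℝ) : Fundamentals I :=
  (fun j => if j = i then aTilde else A j + (vη : ℝ) * va * c i * c j /
      (((vq : ℝ) + vη) * (vq + va) + ((I : ℝ) - 1) * vq * vη) * (aTilde - A i),
    Θ + -(vη : ℝ) * (vq + va) * c i /
      (((vq : ℝ) + vη) * (vq + va) + ((I : ℝ) - 1) * vq * vη) * (aTilde - A i))

theorem longRunFundamentals_isStrictMin {I : ℕ} (i : Fin I) {c : Fin I → ℝ}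
    (hc : ∀ j, c j = 1 ∨ c j = -1) (A : Fin I → ℝ) (Θ : ℝ) {vq vη va : ℝ≥0} (hvq : 0 < vq)
    (hvη : 0 < vη) (hva : 0 < va) (aTilde : ℝ) {f : Fundamentals I} (hf : f.1 i = aTilde)
    (hne : f ≠ longRunFundamentals i c A Θ vq vη va aTilde) :
    (meanSignal c (A, Θ) - meanSignal c (longRunFundamentals i c A Θ vq vη va aTilde)) ⬝ᵥ
      ((Matrix.diagonal fun x : SignalIdx I => (errorVariance vq vη va x : ℝ))⁻¹ *ᵥ
        (meanSignal c (A, Θ) - meanSignal c (longRunFundamentals i c A Θ vq vη va aTilde))) <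
    (meanSignal c (A, Θ) - meanSignal c f) ⬝ᵥ
      ((Matrix.diagonal fun x : SignalIdx I => (errorVariance vq vη va x : ℝ))⁻¹ *ᵥ
        (meanSignal c (A, Θ) - meanSignal c f)) := by
  rw [dotProduct_inv_diagonal_errorVariance hvq hvη hva,
    dotProduct_inv_diagonal_errorVariance hvq hvη hva]
  set f₀ := longRunFundamentals i c A Θ vq vη va aTilde with hf₀
  have hi : f₀.1 i = aTilde := by simp [hf₀, longRunFundamentals]
  obtain ⟨h1, h2⟩ := longRunBias_foc (i := i) hc (NNReal.coe_pos.2 hvq) (NNReal.coe_pos.2 hvη)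
    (NNReal.coe_pos.2 hva) (Δ := aTilde - A i) (τ₀ := Θ - f₀.2) (b₀ := fun j => A j - f₀.1 j) rfl
    (by simp only [hf₀, longRunFundamentals]; ring) (by simp [hi])
    (fun j hj => by simp [hf₀, longRunFundamentals, hj])
  refine weightedSquares_lt (b₀ := fun j => A j - f₀.1 j) (b := fun j => A j - f.1 j)
    (NNReal.coe_pos.2 hvq) (NNReal.coe_pos.2 hvη) (NNReal.coe_pos.2 hva) (by simp [hi, hf]) h1 h2
    fun h => hne ?_
  refine Prod.ext (funext fun j => ?_) ?_
  · exact sub_right_injective (congrFun (Prod.ext_iff.1 h).1 j)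
  · exact sub_right_injective (Prod.ext_iff.1 h).2

end OneGroup

end

/-- Agent `i` observes, in every period, the recognitions, the signal about discrimination and the
signals about calibers of all `I` individuals. He is certain that his own caliber is `aTilde`, and
his prior has full support over the other calibers, discrimination, and all positive definite
covariance matrices of the errors. -/
theorem proposition3 {I : ℕ} (i : Fin I)
    -- membership (`1`) or competition (`-1`), true calibers, true discrimination
    (c : Fin I → ℝ) (hc : ∀ j, c j = 1 ∨ c j = -1) (A : Fin I → ℝ) (Θ : ℝ)
    -- variances of the errors
    (vq vη va : ℝ≥0) (hvq : 0 < vq) (hvη : 0 < vη) (hva : 0 < va)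
    -- the errors: independent across periods and signals, normally distributed
    {Ω : Type*} [MeasurableSpace Ω] (P : Measure Ω) [IsProbabilityMeasure P]
    (ε : ℕ → SignalIdx I → Ω → ℝ)
    (hlaw : ∀ t x, HasLaw (ε t x) (gaussianReal 0 (errorVariance vq vη va x)) P)
    (hindep : iIndepFun (fun (tx : ℕ × SignalIdx I) => ε tx.1 tx.2) P)
    -- overconfidence, and the prior
    (aTilde : ℝ) (hover : A i < aTilde)
    (P₀ : Measure (Fundamentals I × PDMatrix (SignalIdx I))) [IsProbabilityMeasure P₀]
    (hprior : P₀.support = {p | p.1.1 i = aTilde})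
    -- the observed signals
    (r : ℕ → Ω → SignalIdx I → ℝ)
    (hr : ∀ t ω x, r t ω x = meanSignal c (A, Θ) x + ε t x ω) :
    (∃ p, IsLongRunBelief P P₀ (meanSignal c) r p) ∧
    ∀ (a : Fin I → ℝ) (θ : ℝ) (S : PDMatrix (SignalIdx I)),
      IsLongRunBelief P P₀ (meanSignal c) r ((a, θ), S) →
        θ - Θ = -(vη : ℝ) * (vq + va) * c i /
            (((vq : ℝ) + vη) * (vq + va) + ((I : ℝ) - 1) * vq * vη) * (aTilde - A i) ∧
        ∀ j, j ≠ i →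
          a j - A j = (vη : ℝ) * va * c i * c j /
            (((vq : ℝ) + vη) * (vq + va) + ((I : ℝ) - 1) * vq * vη) * (aTilde - A i) := by
  set f₀ := longRunFundamentals i c A Θ vq vη va aTilde with hf₀
  have hV₀ := posDef_diagonal_errorVariance (I := I) hvq hvη hva
  let S₀ : PDMatrix (SignalIdx I) := ⟨_, hV₀.add_posSemidef
    (Matrix.posSemidef_vecMulVec_self (meanSignal c (A, Θ) - meanSignal c f₀))⟩
  have hC : ∀ᵐ p ∂P₀, p.1 ∈ {f : Fundamentals I | f.1 i = aTilde} := by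
    have h : P₀.support ∈ ae P₀ := Measure.support_mem_ae
    rwa [hprior] at h
  have hsupp : (f₀, S₀) ∈ P₀.support := by
    rw [hprior]
    simp [hf₀, longRunFundamentals]
  have hmain : IsLongRunBelief P P₀ (meanSignal c) r (f₀, S₀) := by
    filter_upwards [ae_tendsto_sampleMean_sampleCov P ε _ hlaw hindep] with ω hω
    exact concentratesOn_of_tendsto P₀ hC (continuous_meanSignal c) (meanSignal c (A, Θ))
      (isCompact_setOf_abs_sub_meanSignal_le i c (A, Θ) aTilde) hV₀
      (fun f hf hne => longRunFundamentals_isStrictMin i hc A Θ hvq hvη hva aTilde hf hne) rfl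
      hsupp (fun t => funext fun x => hr t ω x) hω.1 hω.2
  refine ⟨⟨_, hmain⟩, fun a θ S h => ?_⟩
  -- Two almost sure events meet, so along a single path the posteriors concentrate on both points,
  -- which must then agree.
  obtain ⟨ω, h1, h2⟩ := (h.and hmain).exists
  have heq : (a, θ) = f₀ := (Prod.ext_iff.1 (h1.unique h2)).1
  obtain ⟨rfl, rfl⟩ := Prod.ext_iff.1 heq
  refine ⟨?_, fun j hj => ?_⟩
  · simp [hf₀, longRunFundamentals]
  · simp [hf₀, longRunFundamentals, hj]
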